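/- **Friezes.** An infinite frieze is an array of integers $(m_{ij})_{i,j\in\mathbb Z,\ j-i\ge -2}$ with $m_{i,i-2}=0$, $m_{i,i-1}=1$, $m_{ij}>0$ for $i\le j$, and $m_{ij}m_{i+1,j+1}-m_{i+1,j}m_{i,j+1}=1$ for $j-i\ge -1$. For $n\ge 1$ it is $n$-periodic if $m_{ij}=m_{i+n,j+n}$ for all $i\le j$, and then its quiddity sequence is $(m_{11},\dots,m_{nn})$. It is $n$-arithmetic if, for all $i\in\mathbb Z$ and $k\in\{1,\dots,n\}$, the difference $m_{i,(i+k-3)+(l+1)n}-m_{i,(i+k-3)+ln}$ does not depend on $l\ge 0$. **Strip.** For $n\ge 1$ the strip $\mathcal U_n$ is the product of $\mathbb R$ and a closed interval, with vertices $0^{(k)}$ ($k\in\mathbb Z$) on the upper boundary and vertices $1^{(k)},\dots,n^{(k)}$ ($k\in\mathbb Z$) on the lower boundary, ordered from left to right by $k$ and then, on the lower boundary, by the label; one writes $(i+ln)^{(k)}=i^{(k+l)}$ for $l\in\mathbb Z$, so that $i^{(k)}$ is defined for all $i,k\in\mathbb Z$. An arc is a non-self-intersecting curve, up to isotopy, either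 joining two lower vertices that are neither equal nor neighbours (a peripheral arc), or joining $0^{(k)}$ to some $j^{(k)}$ with $1\le j\le n$ (a bridging arc). A triangulation of $\mathcal U_n$ is a maximal collection $\mathcal T$ of arcs that pairwise do not cross in the interior of the strip. It is $n$-periodic if for some $k$ and some $i\in\{1,\dots,n\}$ it contains the bridging arcs $0^{(k)}i^{(k)}$ and $0^{(k+1)}i^{(k+1)}$, and consists of the translates, by all horizontal translations $j^{(l)}\mapsto j^{(l+t)}$ with $t\in\mathbb Z$ (where $0\le j\le n$), of its arcs in the $(n+3)$-gon with vertices $0^{(k)},0^{(k+1)},i^{(k)},(i+1)^{(k)},\dots,i^{(k+1)}$. The regions into which such a triangulation cuts the strip are called its triangles: each is bounded either by three arcs or lower boundary segments, or by two bridging arcs, one peripheral arc or lower boundary segment, and the (possibly degenerate) part of the upper boundary between the two bridging arcs. The quiddity sequence of $\mathcal T$ is $(a_1,\dots,a_n)$, where $a_i$ is the number of triangles of $\mathcal T$ incident with $i^{(0)}$. **Matchings.** For consecutive lower vertices $v_1,\dots,v_s$ ($s\ge 1$), let $\mathcal M_{v_1v_s}(\mathcal T)$ be the set of $s$-tuples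 $(\tau_1,\dots,\tau_s)$ of pairwise distinct triangles of $\mathcal T$ such that $\tau_r$ is incident with $v_r$ for every $r$. **Theorem.** Let $n\ge 1$ and let $\mathcal T_n$ be an $n$-periodic triangulation of $\mathcal U_n$. There is an $n$-periodic infinite frieze $\mathcal F_{\mathcal T_n}=(m_{ij})_{j-i\ge -2}$ whose quiddity sequence is that of $\mathcal T_n$. It is unique and $n$-arithmetic, and for all integers $i\le j$ and $k$ the set $\mathcal M_{i^{(k)}j^{(k)}}(\mathcal T_n)$ is finite and $$m_{ij}=\bigl|\mathcal M_{i^{(k)}j^{(k)}}(\mathcal T_n)\bigr|.$$ -/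

import Mathlib

/-! ### Infinite friezes -/

/-- An infinite frieze `(m_{ij})_{j - i ≥ -2}`; the values `m i j` with `j < i - 2` are not part
of the array and are unconstrained. -/
structure IsInfiniteFrieze (m : ℤ → ℤ → ℤ) : Prop where
  zero_row : ∀ i, m i (i - 2) = 0
  one_row : ∀ i, m i (i - 1) = 1
  pos : ∀ i j, i ≤ j → 0 < m i j
  unimodular : ∀ i j, i - 1 ≤ j → m i j * m (i + 1) (j + 1) - m (i + 1) j * m i (j + 1) = 1

/-- The frieze `m` is `n`-periodic. -/
def IsPeriodicFrieze (n : ℕ) (m : ℤ → ℤ → ℤ) : Prop :=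
  1 ≤ n ∧ ∀ i j, i ≤ j → m i j = m (i + n) (j + n)

/-- The number `d_{ik} = m_{i,(i+k-3)+r} - m_{i,i+k-3}`. -/
def commonDifference (r : ℕ) (m : ℤ → ℤ → ℤ) (i k : ℤ) : ℤ :=
  m i ((i + k - 3) + r) - m i (i + k - 3)

/-- The frieze `m` is `r`-arithmetic: every diagonal splits into `r` arithmetic progressions. -/
def IsArithmeticFrieze (r : ℕ) (m : ℤ → ℤ → ℤ) : Prop :=
  1 ≤ r ∧ ∀ i k : ℤ, 1 ≤ k → k ≤ r → ∀ l : ℕ,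
    m i ((i + k - 3) + ((l : ℤ) + 1) * r) - m i ((i + k - 3) + (l : ℤ) * r)
      = commonDifference r m i k

namespace Strip

/-! ### The strip `U_n` and its arcs

The lower boundary vertices of `U_n` are numbered from left to right by `ℤ`: the vertex `i^{(k)}`
with `1 ≤ i ≤ n` is the one in position `i + k n`. -/

/-- The position on the lower boundary of `i^{(k)}`. It is defined for all integers `i`, so that
`(i + l n)^{(k)} = i^{(k + l)}`. -/
def pos (n : ℕ) (i k : ℤ) : ℤ := i + k * n

/-- The superscript of the lower boundary vertex in position `p`, that is, the integer `k` such
that `p = i + k n` with `1 ≤ i ≤ n` (floor division, for `n ≥ 1`). -/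
def superscript (n : ℕ) (p : ℤ) : ℤ := (p - 1) / (n : ℤ)

/-- The vertices of the strip: `lower p` in position `p` on the lower boundary, and
`upper k = 0^{(k)}` on the upper boundary. -/
inductive Vertex : Type
  | lower (p : ℤ)
  | upper (k : ℤ)

/-- Curves, up to isotopy, joining two distinct vertices of the strip of which at least one is on
the lower boundary. As the strip is simply connected, such a curve is determined up to isotopy by
its endpoints. `peripheral a b` joins the lower vertices in positions `a` and `b` (with `a` on the
left, see `IsArc`), and `bridging k p` joins `0^{(k)}` to the lower vertex in position `p`. -/
inductive Curve : Type
  | peripheral (a b : ℤ)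
  | bridging (k p : ℤ)

/-- The endpoints of a curve. -/
def Curve.endpoints : Curve → Set Vertex
  | .peripheral a b => {.lower a, .lower b}
  | .bridging k p => {.upper k, .lower p}

/-- The arcs of `U_n`: the endpoints of a peripheral arc are neither equal nor neighbours, and the
endpoints of a bridging arc have the same superscript. -/
def IsArc (n : ℕ) : Curve → Prop
  | .peripheral a b => a + 2 ≤ b
  | .bridging k p => k = superscript n p

/-- Two curves cross (that is, all their representatives meet in the interior of the strip) if and
only if their endpoints interlace along the boundary of the strip. -/
def Crosses : Curve → Curve → Prop
  | .peripheral a b, .peripheral c d => (a < c ∧ c < b ∧ b < d) ∨ (c < a ∧ a < d ∧ d < b)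
  | .peripheral a b, .bridging _ p => a < p ∧ p < b
  | .bridging _ p, .peripheral a b => a < p ∧ p < b
  | .bridging k p, .bridging l q => (k < l ∧ q < p) ∨ (l < k ∧ p < q)

/-- A collection of pairwise non-crossing arcs of `U_n`. -/
def IsNonCrossingFamily (n : ℕ) (S : Set Curve) : Prop :=
  (∀ γ ∈ S, IsArc n γ) ∧ ∀ γ ∈ S, ∀ δ ∈ S, ¬ Crosses γ δ

/-- A triangulation of `U_n` is a maximal collection of pairwise non-crossing arcs. -/
def IsTriangulation (n : ℕ) (T : Set Curve) : Prop :=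
  Maximal (IsNonCrossingFamily n) T

/-! ### Periodic triangulations -/

/-- The horizontal translation that takes `i^{(k)}` to `i^{(k + t)}` and `0^{(k)}` to
`0^{(k + t)}`. -/
def translate (n : ℕ) (t : ℤ) : Curve → Curve
  | .peripheral a b => .peripheral (a + t * n) (b + t * n)
  | .bridging k p => .bridging (k + t) (p + t * n)

/-- The vertices of the `(n + 3)`-gon `P` with vertices `0^{(k)}, 0^{(k+1)}` on the upper boundary
and `i^{(k)}, (i+1)^{(k)}, …, i^{(k+1)}` on the lower boundary, where `p` is the position of
`i^{(k)}`. -/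
def polygonVertices (n : ℕ) (p : ℤ) : Set Vertex :=
  {.upper (superscript n p), .upper (superscript n p + 1)} ∪ Vertex.lower '' Set.Icc p (p + n)

/-- The arcs of `T` in the polygon above (its two bridging sides included). -/
def arcsInPolygon (n : ℕ) (T : Set Curve) (p : ℤ) : Set Curve :=
  {γ ∈ T | γ.endpoints ⊆ polygonVertices n p}

/-- The polygon above is a fundamental domain of `T`: its left and right sides are bridging arcs
of `T`, and the translates of its arcs make up `T`. -/
def IsFundamentalDomain (n : ℕ) (T : Set Curve) (p : ℤ) : Prop :=
  Curve.bridging (superscript n p) p ∈ T ∧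
  Curve.bridging (superscript n p + 1) (p + n) ∈ T ∧
  T = ⋃ t : ℤ, translate n t '' arcsInPolygon n T p

/-- `T` is an `n`-periodic triangulation of the strip `U_n`. -/
def IsPeriodicTriangulation (n : ℕ) (T : Set Curve) : Prop :=
  IsTriangulation n T ∧ ∃ p : ℤ, IsFundamentalDomain n T p

/-! ### Triangles, quiddity sequences and matchings -/

/-- `inner a b c` stands for the region with vertices in positions `a, b, c` on the lower boundary;
`outer a b` stands for the region bounded by the bridging arcs at the positions `a` and `b`, by
the side joining `a` to `b`, and by the part of the upper boundary between the bridging arcs (which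
may be one vertex; it is regarded as a single vertex of a triangle). -/
inductive Triangle : Type
  | inner (a b c : ℤ)
  | outer (a b : ℤ)

/-- The lower vertices in positions `a < b` are joined by a boundary segment or an arc of `T`. -/
def IsSide (T : Set Curve) (a b : ℤ) : Prop :=
  b = a + 1 ∨ Curve.peripheral a b ∈ T

/-- The regions into which a periodic triangulation `T` of `U_n` cuts the strip. -/
def IsTriangleOf (n : ℕ) (T : Set Curve) : Triangle → Prop
  | .inner a b c => a < b ∧ b < c ∧ IsSide T a b ∧ IsSide T b c ∧ IsSide T a c
  | .outer a b => a < b ∧ Curve.bridging (superscript n a) a ∈ T ∧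
      Curve.bridging (superscript n b) b ∈ T ∧ IsSide T a b

/-- The triangle is incident with the lower vertex in position `v`. -/
def Triangle.IsIncident : Triangle → ℤ → Prop
  | .inner a b c, v => v = a ∨ v = b ∨ v = c
  | .outer a b, v => v = a ∨ v = b

/-- The quiddity sequence of `T`: the number `a_i` of triangles of `T` incident with `i^{(0)}`. -/
noncomputable def quiddity (n : ℕ) (T : Set Curve) (i : ℤ) : ℕ :=
  {τ : Triangle | IsTriangleOf n T τ ∧ τ.IsIncident (pos n i 0)}.ncard

/-- `m` is the frieze associated with `T`: the `n`-periodic infinite frieze whose quiddity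
sequence `(m_{11}, …, m_{nn})` is the quiddity sequence of `T`. -/
def IsAssociatedFrieze (n : ℕ) (T : Set Curve) (m : ℤ → ℤ → ℤ) : Prop :=
  IsInfiniteFrieze m ∧ IsPeriodicFrieze n m ∧
    ∀ i : ℤ, 1 ≤ i → i ≤ n → m i i = (quiddity n T i : ℤ)

/-- The matchings between the consecutive lower vertices in positions `u, u + 1, …, v` and `T`:
the tuples of pairwise distinct triangles of `T`, indexed by these vertices, such that each
triangle is incident with the vertex that it is assigned to. -/
def matchings (n : ℕ) (T : Set Curve) (u v : ℤ) : Set (Set.Icc u v → Triangle) :=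
  {τ | Function.Injective τ ∧ ∀ w, IsTriangleOf n T (τ w) ∧ (τ w).IsIncident w}

end Strip

/-! Fix i and let D(p) = `diag n T i p` be the number of matchings of the vertices i, …, p-1; the
frieze entry m_{ij} will be D(j+1). The engine is a rigidity fact, `count_side`: the vertices
strictly beneath a side ab are incident only with triangles beneath ab, and there is exactly one way
to match the two. So matchings of i, …, b-1 amount to matchings of i, …, a that avoid the triangles
beneath ab.

Deciding which triangle goes to one vertex then yields linear relations: D(b) = D(a) + D(c) for an
inner triangle abc (`diag_inner`), and equal increments of D along consecutive bridging arcs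
(`diag_outer`). Summing, over the triangles at p, the number of matchings that use each of them
gives D(p-1) (`sum_fan`), hence D(p+1) = a_p D(p) - D(p-1) (`diag_succ`).

This recurrence, with coefficients independent of i, gives the unimodular rule and periodicity;
positivity comes from one explicit matching (`diag_pos`). Conversely the unimodular rule and the
quiddity sequence determine every entry (`IsAssociatedFrieze.eq_diag`). For arithmeticity, the
second difference of D over one period solves the same recurrence and vanishes at bridging positions
q and q+n; as solutions that vanish at q are multiples of a positive one, it is zero
(`diag_second_difference`). -/

namespace Strip

variable {n : ℕ} {T : Set Curve}

/-! ### Non-crossing sides and existence of triangles -/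

/-- The triangulation `T` contains the bridging arc ending at the lower vertex `p`. -/
def IsBridge (n : ℕ) (T : Set Curve) (p : ℤ) : Prop :=
  Curve.bridging (superscript n p) p ∈ T

theorem superscript_mono (hn : 1 ≤ n) {p q : ℤ} (h : p ≤ q) : superscript n p ≤ superscript n q := by
  unfold superscript
  exact Int.ediv_le_ediv (by exact_mod_cast hn) (by omega)

theorem superscript_add_mul (hn : 1 ≤ n) (p t : ℤ) :
    superscript n (p + t * n) = superscript n p + t := by
  unfold superscript
  rw [show p + t * (n : ℤ) - 1 = (p - 1) + t * n by ring, Int.add_mul_ediv_right]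
  exact_mod_cast (by omega : n ≠ 0)

theorem isSide_succ (T : Set Curve) (a : ℤ) : IsSide T a (a + 1) := Or.inl rfl

theorem IsSide.lt (hT : IsTriangulation n T) {a b : ℤ} (h : IsSide T a b) : a < b := by
  rcases h with h | h
  · omega
  · have := hT.1.1 _ h
    simp only [IsArc] at this
    omega

theorem IsSide.mem {a b : ℤ} (h : IsSide T a b) (hab : a + 2 ≤ b) : Curve.peripheral a b ∈ T := by
  rcases h with h | h
  · omega
  · exact h

theorem IsSide.not_interlace (hT : IsTriangulation n T) {a b c d : ℤ} (h : IsSide T a b)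
    (h' : IsSide T c d) (h1 : a < c) (h2 : c < b) : d ≤ b := by
  by_contra! h3
  exact hT.1.2 _ (h.mem (by omega)) _ (h'.mem (by omega)) (Or.inl ⟨h1, h2, h3⟩)

theorem IsBridge.not_inside (hT : IsTriangulation n T) {a b p : ℤ} (hp : IsBridge n T p)
    (h : IsSide T a b) (h1 : a < p) : b ≤ p := by
  by_contra! h2
  exact hT.1.2 _ (h.mem (by omega)) _ hp ⟨h1, h2⟩

/-- Maximality of `T`, in the form used to produce arcs. -/
theorem mem_of_not_crosses (hT : IsTriangulation n T) {γ : Curve} (hγ : IsArc n γ)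
    (h0 : ¬ Crosses γ γ) (h : ∀ δ ∈ T, ¬ Crosses γ δ ∧ ¬ Crosses δ γ) : γ ∈ T := by
  have : IsNonCrossingFamily n (insert γ T) := by
    refine ⟨?_, ?_⟩
    · rintro δ (rfl | hδ)
      · exact hγ
      · exact hT.1.1 _ hδ
    · rintro δ (rfl | hδ) ε (rfl | hε)
      · exact h0
      · exact (h _ hε).1
      · exact (h _ hδ).2
      · exact hT.1.2 _ hδ _ hε
  exact hT.2 this (Set.subset_insert _ _) (Set.mem_insert _ _)

theorem isSide_of_not_crosses (hT : IsTriangulation n T) {a b : ℤ} (hab : a < b)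
    (hB : ∀ p, IsBridge n T p → a < p → b ≤ p)
    (hS : ∀ c d, IsSide T c d → ¬ (a < c ∧ c < b ∧ b < d) ∧ ¬ (c < a ∧ a < d ∧ d < b)) :
    IsSide T a b := by
  by_cases h : b = a + 1
  · exact Or.inl h
  refine Or.inr (mem_of_not_crosses hT (by simp only [IsArc]; omega)
    (by simp only [Crosses]; omega) ?_)
  rintro (⟨c, d⟩ | ⟨k, p⟩) hδ
  · have := hS c d (Or.inr hδ)
    simp only [Crosses]
    omega
  · have h1 : k = superscript n p := hT.1.1 _ hδ
    subst h1
    have h2 := hB p hδ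
    simp only [Crosses]
    omega

/-- Only peripheral arcs can obstruct a bridging arc: superscripts are monotone in the position, so
two bridging arcs never cross. -/
theorem isBridge_of_not_inside (hn : 1 ≤ n) (hT : IsTriangulation n T) {p : ℤ}
    (hS : ∀ c d, IsSide T c d → c < p → d ≤ p) : IsBridge n T p := by
  refine mem_of_not_crosses hT rfl (by simp only [Crosses]; omega) ?_
  rintro (⟨c, d⟩ | ⟨k, q⟩) hδ
  · have := hS c d (Or.inr hδ)
    simp only [Crosses]
    omega
  · have h1 : k = superscript n q := hT.1.1 _ hδ
    have h2 : p ≤ q → superscript n p ≤ superscript n q := superscript_mono hn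
    have h3 : q ≤ p → superscript n q ≤ superscript n p := superscript_mono hn
    simp only [Crosses]
    omega

theorem exists_greatest_int {P : ℤ → Prop} {a b : ℤ} (ha : P a) (hab : a < b) :
    ∃ m, a ≤ m ∧ m < b ∧ P m ∧ ∀ x, P x → x < b → x ≤ m := by
  classical
  obtain ⟨m, ⟨h1, h2⟩, h3⟩ := Int.exists_greatest_of_bdd (P := fun x => P x ∧ x < b)
    ⟨b, fun z hz => hz.2.le⟩ ⟨a, ha, hab⟩
  exact ⟨m, h3 a ⟨ha, hab⟩, h2, h1, fun x hx hxb => h3 x ⟨hx, hxb⟩⟩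

/-- Every peripheral arc bounds a triangle from above. -/
theorem IsSide.exists_apex (hT : IsTriangulation n T) {a b : ℤ} (h : IsSide T a b)
    (hab : a + 2 ≤ b) : ∃ m, IsTriangleOf n T (.inner a m b) := by
  -- The apex is the far end of the longest side from `a` shorter than ab; an arc crossing mb would
  -- have to be a longer such side.
  obtain ⟨m, h1, h2, h3, h4⟩ := exists_greatest_int (P := fun m => IsSide T a m)
    (isSide_succ T a) (show a + 1 < b by omega)
  refine ⟨m, by omega, h2, h3, ?_, h⟩
  refine isSide_of_not_crosses hT h2 (fun p hp hmp => hp.not_inside hT h (by omega)) ?_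
  intro c d hcd
  refine ⟨fun hc => ?_, fun hc => ?_⟩
  · have := h.not_interlace hT hcd (by omega) (by omega)
    omega
  · rcases lt_trichotomy c a with hca | rfl | hca
    · have := hcd.not_interlace hT h hca (by omega)
      omega
    · have := h4 d hcd hc.2.2
      omega
    · have := h3.not_interlace hT hcd hca hc.1
      omega

/-- Every side bounds a region from below. -/
theorem IsSide.exists_above (hn : 1 ≤ n) (hT : IsTriangulation n T) {v p : ℤ} (h : IsSide T v p) :
    (∃ x, IsTriangleOf n T (.inner x v p)) ∨ (∃ x, IsTriangleOf n T (.inner v p x)) ∨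
      IsTriangleOf n T (.outer v p) := by
  have hvp := h.lt hT
  -- The inequality `c + p < v + d` says that cd is not vp itself. If such sides exist, the triangle
  -- beneath the shortest one has vp as a side; if not, nothing covers `v` or `p`, and both carry
  -- bridging arcs.
  by_cases hab : ∃ k : ℕ, ∃ c d, IsSide T c d ∧ c ≤ v ∧ p ≤ d ∧ c + p < v + d ∧ d - c = k
  · classical
    obtain ⟨c, d, hcd, hc, hd, hne, hk⟩ := Nat.find_spec hab
    have hmin : ∀ c' d', IsSide T c' d' → c' ≤ v → p ≤ d' → d' - c' < d - c → c' = v ∧ d' = p := by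
      intro c' d' h' hc' hd' hlt
      by_contra hcon
      have := Nat.find_min' hab (m := (d' - c').toNat) ⟨c', d', h', hc', hd', by omega, by omega⟩
      omega
    obtain ⟨m, hcm, hmd, s1, s2, -⟩ := hcd.exists_apex hT (by omega)
    have hm : m ≤ v ∨ p ≤ m := by
      by_contra! hm
      rcases hc.lt_or_eq with hcv | rfl
      · have := s1.not_interlace hT h hcv hm.1
        omega
      · have := h.not_interlace hT s2 hm.1 hm.2
        omega
    rcases hm with hm | hm
    · obtain ⟨rfl, rfl⟩ := hmin m d s2 hm hd (by omega)
      exact Or.inl ⟨c, hcm, hmd, s1, s2, hcd⟩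
    · obtain ⟨rfl, rfl⟩ := hmin c m s1 hc hm (by omega)
      exact Or.inr (Or.inl ⟨d, hcm, hmd, s1, s2, hcd⟩)
  · have hab' : ∀ c d, IsSide T c d → c ≤ v → p ≤ d → c = v ∧ d = p := by
      intro c d hcd hc hd
      by_contra hcon
      exact hab ⟨(d - c).toNat, c, d, hcd, hc, hd, by omega, by omega⟩
    refine Or.inr (Or.inr ⟨hvp, isBridge_of_not_inside hn hT ?_, isBridge_of_not_inside hn hT ?_, h⟩)
    · intro c d hcd hc
      by_contra! hd
      have h1 := hcd.not_interlace hT h hc hd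
      have := hab' c d hcd hc.le h1
      omega
    · intro c d hcd hc
      by_contra! hd
      rcases le_or_gt c v with hcv | hcv
      · have := hab' c d hcd hcv hd.le
        omega
      · have := h.not_interlace hT hcd hcv hc
        omega

/-- Between two bridging arcs, the right one bounds an outer triangle on its left. -/
theorem IsBridge.exists_outer (hT : IsTriangulation n T) {q b : ℤ} (hq : IsBridge n T q)
    (hb : IsBridge n T b) (hqb : q < b) : ∃ a, q ≤ a ∧ IsTriangleOf n T (.outer a b) := by
  obtain ⟨a, h1, h2, h3, h4⟩ := exists_greatest_int (P := IsBridge n T) hq hqb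
  refine ⟨a, h1, h2, h3, hb, isSide_of_not_crosses hT h2 ?_ ?_⟩
  · intro p hp hap
    by_contra! hpb
    have := h4 p hp hpb
    omega
  · intro c d hcd
    refine ⟨fun hc => ?_, fun hc => ?_⟩
    · have := hb.not_inside hT hcd hc.2.1
      omega
    · have := h3.not_inside hT hcd hc.1
      omega

/-- Some side passes over `p`; the apex beneath the shortest such side must be `p`, since otherwise
a shorter one would pass over it. -/
theorem exists_middle (hn : 1 ≤ n) (hT : IsTriangulation n T) {p : ℤ} (hp : ¬ IsBridge n T p) :
    ∃ a c, IsTriangleOf n T (.inner a p c) := by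
  have hex : ∃ k : ℕ, ∃ c d, IsSide T c d ∧ c < p ∧ p < d ∧ d - c = k := by
    by_contra hcon
    refine hp (isBridge_of_not_inside hn hT ?_)
    intro c d hcd hc
    by_contra! hd
    exact hcon ⟨(d - c).toNat, c, d, hcd, hc, hd, by omega⟩
  classical
  obtain ⟨c, d, hcd, hc, hd, hk⟩ := Nat.find_spec hex
  have hmin : ∀ c' d', IsSide T c' d' → c' < p → p < d' → d - c ≤ d' - c' := by
    intro c' d' h' hc' hd'
    have := Nat.find_min' hex (m := (d' - c').toNat) ⟨c', d', h', hc', hd', by omega⟩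
    omega
  obtain ⟨m, hcm, hmd, s1, s2, -⟩ := hcd.exists_apex hT (by omega)
  have : m = p := by
    rcases lt_trichotomy m p with h | h | h
    · have := hmin m d s2 h hd
      omega
    · exact h
    · have := hmin c m s1 hc h
      omega
  subst this
  exact ⟨c, d, hcm, hmd, s1, s2, hcd⟩

/-! ### Triangles beneath a side -/

/-- The triangles of `T` all of whose vertices lie between `a` and `b`, outer triangles excepted. -/
def beneath (n : ℕ) (T : Set Curve) (a b : ℤ) : Set Triangle :=
  {τ | ∃ x y z, τ = .inner x y z ∧ IsTriangleOf n T τ ∧ a ≤ x ∧ z ≤ b}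

theorem mem_beneath {a b x y z : ℤ} : Triangle.inner x y z ∈ beneath n T a b ↔
    IsTriangleOf n T (.inner x y z) ∧ a ≤ x ∧ z ≤ b := by
  constructor
  · rintro ⟨x', y', z', h, h'⟩
    cases h
    exact h'
  · exact fun h => ⟨x, y, z, rfl, h⟩

theorem outer_notMem_beneath {a b x y : ℤ} : Triangle.outer x y ∉ beneath n T a b := by
  rintro ⟨x', y', z', h, h'⟩
  cases h

theorem beneath_succ (n : ℕ) (T : Set Curve) (a : ℤ) : beneath n T a (a + 1) = ∅ := by
  ext τ
  simp only [Set.mem_empty_iff_false, iff_false]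
  rintro ⟨x, y, z, rfl, h, hx, hz⟩
  have := h.1
  have := h.2.1
  omega

theorem beneath_mono {a b c d : ℤ} (h1 : c ≤ a) (h2 : b ≤ d) :
    beneath n T a b ⊆ beneath n T c d := by
  rintro _ ⟨x, y, z, rfl, h, hx, hz⟩
  exact mem_beneath.2 ⟨h, by omega, by omega⟩

theorem IsTriangleOf.incident_of_mem_beneath {τ : Triangle} {a b r : ℤ} (h : τ ∈ beneath n T a b)
    (hr : τ.IsIncident r) : a ≤ r ∧ r ≤ b := by
  obtain ⟨x, y, z, rfl, h, hx, hz⟩ := h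
  have := h.1
  have := h.2.1
  simp only [Triangle.IsIncident] at hr
  omega

/-- A triangle beneath ab with vertices on both sides of m must reach exactly from a to b, or its
long side would cross am or mb; its middle vertex is then m. -/
theorem eq_or_mem_beneath (hT : IsTriangulation n T) {a m b : ℤ}
    (h : IsTriangleOf n T (.inner a m b)) {τ : Triangle} (hτ : τ ∈ beneath n T a b) :
    τ = .inner a m b ∨ τ ∈ beneath n T a m ∨ τ ∈ beneath n T m b := by
  obtain ⟨x, y, z, rfl, hxyz, hx, hz⟩ := hτ
  obtain ⟨h1, h2, s1, s2, s3⟩ := h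
  by_cases hzm : z ≤ m
  · exact Or.inr (Or.inl (mem_beneath.2 ⟨hxyz, hx, hzm⟩))
  by_cases hxm : m ≤ x
  · exact Or.inr (Or.inr (mem_beneath.2 ⟨hxyz, hxm, hz⟩))
  obtain ⟨k1, k2, t1, t2, t3⟩ := hxyz
  left
  have hxa : x = a := by
    by_contra hne
    have := s1.not_interlace hT t3 (by omega) (by omega)
    omega
  have hzb : z = b := by
    by_contra hne
    have := t3.not_interlace hT s2 (by omega) (by omega)
    omega
  subst hxa hzb
  rcases lt_trichotomy y m with hy | rfl | hy
  · have := s1.not_interlace hT t2 k1 hy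
    omega
  · rfl
  · have := t1.not_interlace hT s2 h1 hy
    omega

/-- The triangles at a vertex strictly beneath a side lie beneath that side. -/
theorem mem_beneath_of_isIncident (hT : IsTriangulation n T) {a m b : ℤ} (h : IsSide T a b)
    (ham : a < m) (hmb : m < b) {τ : Triangle} (hτ : IsTriangleOf n T τ) (hm : τ.IsIncident m) :
    τ ∈ beneath n T a b := by
  have hl : ∀ x, IsSide T x m → a ≤ x := by
    intro x hx
    by_contra! hlt
    have := hx.not_interlace hT h hlt ham
    omega
  have hr : ∀ x, IsSide T m x → x ≤ b := fun x hx => h.not_interlace hT hx ham hmb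
  rcases τ with ⟨x, y, z⟩ | ⟨x, y⟩
  · refine mem_beneath.2 ⟨hτ, ?_⟩
    obtain ⟨k1, k2, t1, t2, t3⟩ := hτ
    rcases hm with rfl | rfl | rfl
    · exact ⟨ham.le, hr _ t3⟩
    · exact ⟨hl _ t1, hr _ t2⟩
    · exact ⟨hl _ t3, hmb.le⟩
  · obtain ⟨k1, b1, b2, -⟩ := hτ
    rcases hm with rfl | rfl
    · have := IsBridge.not_inside hT b1 h ham
      omega
    · have := IsBridge.not_inside hT b2 h ham
      omega

/-- A region lying above a side, and having both ends of the side as vertices. -/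
def IsAbove (v p : ℤ) (τ : Triangle) : Prop :=
  (∃ x, τ = .inner x v p) ∨ (∃ x, τ = .inner v p x) ∨ τ = .outer v p

theorem IsAbove.notMem_beneath {v p : ℤ} {τ : Triangle} (h : IsAbove v p τ) :
    τ ∉ beneath n T v p := by
  rcases h with ⟨x, rfl⟩ | ⟨x, rfl⟩ | rfl
  · rw [mem_beneath]
    rintro ⟨⟨h, -⟩, h', -⟩
    omega
  · rw [mem_beneath]
    rintro ⟨⟨-, h, -⟩, -, h'⟩
    omega
  · exact outer_notMem_beneath

/-- Two different regions above the same side would have crossing sides, or a side passing over a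
bridging arc. -/
theorem IsAbove.unique (hT : IsTriangulation n T) {v p : ℤ} {σ τ : Triangle} (h : IsAbove v p σ)
    (h' : IsAbove v p τ) (hσ : IsTriangleOf n T σ) (hτ : IsTriangleOf n T τ) : σ = τ := by
  have key1 : ∀ x y, IsTriangleOf n T (.inner x v p) → IsTriangleOf n T (.inner y v p) → y ≤ x := by
    rintro x y ⟨k1, k2, t1, t2, t3⟩ ⟨l1, l2, u1, u2, u3⟩
    by_contra! hxy
    have := t1.not_interlace hT u3 hxy l1
    omega
  have key2 : ∀ x y, IsTriangleOf n T (.inner v p x) → IsTriangleOf n T (.inner v p y) → x ≤ y := by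
    rintro x y ⟨k1, k2, t1, t2, t3⟩ ⟨l1, l2, u1, u2, u3⟩
    exact u3.not_interlace hT t2 k1 l2
  have key3 : ∀ x y, IsTriangleOf n T (.inner x v p) → IsTriangleOf n T (.inner v p y) → False := by
    rintro x y ⟨k1, k2, t1, t2, t3⟩ ⟨l1, l2, u1, u2, u3⟩
    have := t3.not_interlace hT u3 k1 k2
    omega
  have key4 : ∀ x, IsTriangleOf n T (.inner x v p) → IsTriangleOf n T (.outer v p) → False := by
    rintro x ⟨k1, k2, t1, t2, t3⟩ ⟨l1, b1, b2, -⟩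
    have := IsBridge.not_inside hT b1 t3 k1
    omega
  have key5 : ∀ x, IsTriangleOf n T (.inner v p x) → IsTriangleOf n T (.outer v p) → False := by
    rintro x ⟨k1, k2, t1, t2, t3⟩ ⟨l1, b1, b2, -⟩
    have := IsBridge.not_inside hT b2 t3 k1
    omega
  rcases h with ⟨x, rfl⟩ | ⟨x, rfl⟩ | rfl <;> rcases h' with ⟨y, rfl⟩ | ⟨y, rfl⟩ | rfl
  · rw [le_antisymm (key1 y x hτ hσ) (key1 x y hσ hτ)]
  · exact (key3 _ _ hσ hτ).elim
  · exact (key4 _ hσ hτ).elim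
  · exact (key3 _ _ hτ hσ).elim
  · rw [le_antisymm (key2 x y hσ hτ) (key2 y x hτ hσ)]
  · exact (key5 _ hσ hτ).elim
  · exact (key4 _ hτ hσ).elim
  · exact (key5 _ hτ hσ).elim
  · rfl

theorem IsTriangleOf.isSide {τ : Triangle} (hτ : IsTriangleOf n T τ) {x p : ℤ} (hx : τ.IsIncident x)
    (hp : τ.IsIncident p) (hxp : x < p) : IsSide T x p := by
  rcases τ with ⟨a, b, c⟩ | ⟨a, b⟩
  · obtain ⟨k1, k2, t1, t2, t3⟩ := hτ
    rcases hx with rfl | rfl | rfl <;> rcases hp with rfl | rfl | rfl <;>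
      first | assumption | omega
  · obtain ⟨k1, b1, b2, t⟩ := hτ
    rcases hx with rfl | rfl <;> rcases hp with rfl | rfl <;>
      first | assumption | omega

theorem IsTriangleOf.beneath_or_isAbove {τ : Triangle} (hτ : IsTriangleOf n T τ) {v p : ℤ}
    (hv : τ.IsIncident v) (hp : τ.IsIncident p) (hvp : v < p) :
    τ ∈ beneath n T v p ∨ IsAbove v p τ := by
  rcases τ with ⟨a, b, c⟩ | ⟨a, b⟩
  · obtain ⟨k1, k2, t1, t2, t3⟩ := id hτ
    rcases hv with rfl | rfl | rfl <;> rcases hp with rfl | rfl | rfl <;> first | omega | skip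
    · exact Or.inr (Or.inr (Or.inl ⟨_, rfl⟩))
    · exact Or.inl (mem_beneath.2 ⟨hτ, le_rfl, le_rfl⟩)
    · exact Or.inr (Or.inl ⟨_, rfl⟩)
  · obtain ⟨k1, -⟩ := hτ
    rcases hv with rfl | rfl <;> rcases hp with rfl | rfl <;> first | omega | skip
    exact Or.inr (Or.inr (Or.inr rfl))

/-- If the region `σ` above the side `v p` has no vertex in `[i, v)`, then the other triangles at
`p` have no vertex in `[i, p)`, unless they lie beneath `v p`. -/
theorem IsAbove.eq_of_isIncident (hT : IsTriangulation n T) {i v p : ℤ} {σ τ : Triangle}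
    (hS : IsSide T v p) (h : IsAbove v p σ) (hσ : IsTriangleOf n T σ)
    (hi : ∀ x, i ≤ x → x < v → ¬ σ.IsIncident x) (hτ : IsTriangleOf n T τ) (hp : τ.IsIncident p)
    (hb : τ ∉ beneath n T v p) {x : ℤ} (hix : i ≤ x) (hxp : x < p) (hx : τ.IsIncident x) :
    σ = τ := by
  rcases lt_trichotomy v x with hvx | rfl | hxv
  · exact (hb (mem_beneath_of_isIncident hT hS hvx hxp hτ hx)).elim
  · exact h.unique hT ((hτ.beneath_or_isAbove hx hp hxp).resolve_left hb) hσ hτ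
  · exfalso
    have s := hτ.isSide hx hp hxp
    have hvp := hS.lt hT
    rcases h with ⟨y, rfl⟩ | ⟨y, rfl⟩ | rfl
    · obtain ⟨k1, k2, t1, t2, t3⟩ := hσ
      have hyx : y < x := by
        by_contra! hxy
        exact hi y (by omega) k1 (Or.inl rfl)
      have := t1.not_interlace hT s hyx hxv
      omega
    · obtain ⟨k1, k2, t1, t2, t3⟩ := hσ
      have := s.not_interlace hT t3 hxv hvp
      omega
    · have := IsBridge.not_inside hT hσ.2.1 s hxv
      omega

/-! ### Periodicity and local finiteness -/

theorem mem_translate (hP : IsPeriodicTriangulation n T) {γ : Curve} (h : γ ∈ T) (t : ℤ) :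
    translate n t γ ∈ T := by
  obtain ⟨-, p, -, -, hp⟩ := hP
  rw [hp] at h ⊢
  obtain ⟨s, δ, hδ, rfl⟩ := Set.mem_iUnion.1 h
  refine Set.mem_iUnion.2 ⟨s + t, δ, hδ, ?_⟩
  rcases δ with ⟨a, b⟩ | ⟨k, q⟩ <;> simp only [translate] <;> congr 1 <;> ring

theorem IsSide.add_mul (hP : IsPeriodicTriangulation n T) {a b : ℤ} (h : IsSide T a b) (t : ℤ) :
    IsSide T (a + t * n) (b + t * n) := by
  rcases h with h | h
  · left
    omega
  · exact Or.inr (mem_translate hP h t)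

theorem IsBridge.add_mul (hn : 1 ≤ n) (hP : IsPeriodicTriangulation n T) {p : ℤ}
    (h : IsBridge n T p) (t : ℤ) : IsBridge n T (p + t * n) := by
  unfold IsBridge
  rw [superscript_add_mul hn]
  exact mem_translate hP h t

theorem exists_isBridge_lt (hn : 1 ≤ n) (hP : IsPeriodicTriangulation n T) (v : ℤ) :
    ∃ q < v, IsBridge n T q := by
  obtain ⟨p, hp, -⟩ := id hP.2
  have hn' : (1 : ℤ) ≤ n := by exact_mod_cast hn
  have h1 := le_abs_self p
  have h2 := neg_abs_le v
  have h3 := abs_nonneg p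
  have h4 := abs_nonneg v
  exact ⟨p + (-(|v| + |p| + 1)) * n, by nlinarith, IsBridge.add_mul hn hP hp _⟩

theorem exists_isBridge_gt (hn : 1 ≤ n) (hP : IsPeriodicTriangulation n T) (v : ℤ) :
    ∃ q > v, IsBridge n T q := by
  obtain ⟨p, hp, -⟩ := id hP.2
  have hn' : (1 : ℤ) ≤ n := by exact_mod_cast hn
  have h1 := neg_abs_le p
  have h2 := le_abs_self v
  have h3 := abs_nonneg p
  have h4 := abs_nonneg v
  exact ⟨p + (|v| + |p| + 1) * n, by nlinarith, IsBridge.add_mul hn hP hp _⟩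

/-- Periodicity supplies bridging arcs on both sides of `v`, and no triangle at `v` extends beyond
them. -/
theorem finite_incident (hn : 1 ≤ n) (hP : IsPeriodicTriangulation n T) (v : ℤ) :
    {τ : Triangle | IsTriangleOf n T τ ∧ τ.IsIncident v}.Finite := by
  obtain ⟨q, hqv, hq⟩ := exists_isBridge_lt hn hP v
  obtain ⟨r, hvr, hr⟩ := exists_isBridge_gt hn hP v
  have key : ∀ τ, IsTriangleOf n T τ → τ.IsIncident v → ∀ x, τ.IsIncident x → x ∈ Set.Icc q r := by
    intro τ hτ hv x hx
    rcases lt_trichotomy x v with h | rfl | h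
    · refine ⟨?_, by omega⟩
      by_contra! hlt
      have := hq.not_inside hP.1 (hτ.isSide hx hv h) hlt
      omega
    · exact ⟨hqv.le, hvr.le⟩
    · refine ⟨by omega, ?_⟩
      by_contra! hlt
      have := hr.not_inside hP.1 (hτ.isSide hv hx h) hvr
      omega
  have hI := Set.finite_Icc q r
  refine (((hI.prod (hI.prod hI)).image fun x => Triangle.inner x.1 x.2.1 x.2.2).union
    ((hI.prod hI).image fun x => Triangle.outer x.1 x.2)).subset ?_
  rintro (⟨a, b, c⟩ | ⟨a, b⟩) ⟨hτ, hv⟩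
  · exact Or.inl ⟨(a, b, c), ⟨key _ hτ hv a (Or.inl rfl), key _ hτ hv b (Or.inr (Or.inl rfl)),
      key _ hτ hv c (Or.inr (Or.inr rfl))⟩, rfl⟩
  · exact Or.inr ⟨(a, b), ⟨key _ hτ hv a (Or.inl rfl), key _ hτ hv b (Or.inr rfl)⟩, rfl⟩

open Classical in
/-- The finite set of triangles incident with the lower vertex `v`. -/
noncomputable def incident (n : ℕ) (T : Set Curve) (v : ℤ) : Finset Triangle :=
  if h : {τ : Triangle | IsTriangleOf n T τ ∧ τ.IsIncident v}.Finite then h.toFinset else ∅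

theorem mem_incident (hn : 1 ≤ n) (hP : IsPeriodicTriangulation n T) {v : ℤ} {τ : Triangle} :
    τ ∈ incident n T v ↔ IsTriangleOf n T τ ∧ τ.IsIncident v := by
  rw [incident, dif_pos (finite_incident hn hP v), Set.Finite.mem_toFinset, Set.mem_ofPred_eq]

/-! ### Counting systems of distinct representatives -/

section Count

variable {α : Type*} (inc : ℤ → Finset α) (i : ℤ)

open Classical in
/-- The number of ways of choosing distinct elements outside `X`, one in each of the sets
`inc i, …, inc (i + k - 1)`. -/
noncomputable def countLength : ℕ → Set α → ℤ
  | 0, _ => 1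
  | k + 1, X => ∑ τ ∈ inc (i + k) with τ ∉ X, countLength k (insert τ X)

/-- The number of ways of choosing distinct elements outside `X`, one in each of the sets
`inc i, …, inc (p - 1)`. -/
noncomputable def count (p : ℤ) (X : Set α) : ℤ := countLength inc i (p - i).toNat X

theorem count_self (X : Set α) : count inc i i X = 1 := by
  simp [count, countLength]

open Classical in
theorem count_succ {p : ℤ} (h : i ≤ p) (X : Set α) :
    count inc i (p + 1) X = ∑ τ ∈ inc p with τ ∉ X, count inc i p (insert τ X) := by
  unfold count
  rw [show (p + 1 - i).toNat = (p - i).toNat + 1 by omega, countLength,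
    show i + ((p - i).toNat : ℤ) = p by omega]

/-- Only the trace of the forbidden set on `inc i, …, inc (p - 1)` matters. -/
theorem count_congr {p : ℤ} (hp : i ≤ p) : ∀ {X Y : Set α},
    (∀ r, i ≤ r → r < p → ∀ τ ∈ inc r, τ ∈ X ↔ τ ∈ Y) → count inc i p X = count inc i p Y := by
  classical
  induction p, hp using Int.leInduction with
  | base => intro X Y _; rw [count_self, count_self]
  | succ p hp ih =>
    intro X Y h
    rw [count_succ _ _ hp, count_succ _ _ hp,
      Finset.filter_congr (fun τ hτ => not_congr (h p hp (by omega) τ hτ))]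
    refine Finset.sum_congr rfl fun τ _ => ih fun r h1 h2 σ hσ => ?_
    rw [Set.mem_insert_iff, Set.mem_insert_iff, h r h1 (by omega) σ hσ]

/-- The choice `θ` contributes one, and no term of the recursive sum is negative. -/
theorem count_pos {p : ℤ} (hp : i ≤ p) (θ : ℤ → α) (hθ : Function.Injective θ)
    (hinc : ∀ r, θ r ∈ inc r) : ∀ {X : Set α}, (∀ r, i ≤ r → r < p → θ r ∉ X) →
    0 < count inc i p X := by
  classical
  have hnn : ∀ k X, 0 ≤ countLength inc i k X := by
    intro k
    induction k with
    | zero => intro X; simp [countLength]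
    | succ k ih => intro X; exact Finset.sum_nonneg fun τ _ => ih _
  induction p, hp using Int.leInduction with
  | base => intro X _; rw [count_self]; exact one_pos
  | succ p hp ih =>
    intro X h
    rw [count_succ _ _ hp]
    refine Finset.sum_pos' (fun τ _ => hnn _ _)
      ⟨θ p, Finset.mem_filter.2 ⟨hinc p, h p hp (by omega)⟩, ih fun r h1 h2 => ?_⟩
    rintro (h3 | h3)
    · have := hθ h3
      omega
    · exact h r h1 (by omega) h3

-- Splitting off the last entry of a tuple matches the recursion: the rest must be injective and
-- avoid both `X` and that entry.
open Classical in
theorem countLength_eq_card (k : ℕ) : ∀ X : Set α, countLength inc i k X =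
    (((Fintype.piFinset fun r : Fin k => inc (i + (r : ℕ))).filter
      fun g => Function.Injective g ∧ ∀ r, g r ∉ X).card : ℤ) := by
  induction k with
  | zero =>
    intro X
    rw [countLength, Finset.filter_true_of_mem, Fintype.card_piFinset]
    · simp
    · exact fun g _ => ⟨fun a => a.elim0, fun a => a.elim0⟩
  | succ k ih =>
    intro X
    rw [countLength, Finset.sum_congr rfl fun τ _ => ih (insert τ X), ← Nat.cast_sum,
      ← Finset.card_sigma]
    congr 1
    refine Finset.card_bij (fun x _ => Fin.snoc (α := fun _ => α) x.2 x.1) ?_ ?_ ?_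
    · rintro ⟨τ, g⟩ h
      simp only [Finset.mem_sigma, Finset.mem_filter, Fintype.mem_piFinset,
        Set.mem_insert_iff, not_or] at h ⊢
      obtain ⟨⟨h1, h2⟩, h3, h4, h5⟩ := h
      refine ⟨?_, ?_, ?_⟩
      · intro r
        refine Fin.lastCases ?_ (fun r => ?_) r
        · simpa using h1
        · simpa using h3 r
      · rw [Fin.snoc_injective_iff]
        exact ⟨h4, fun ⟨r, hr⟩ => (h5 r).1 hr⟩
      · intro r
        refine Fin.lastCases ?_ (fun r => ?_) r
        · simpa using h2
        · simpa using (h5 r).2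
    · rintro ⟨τ, g⟩ - ⟨σ, f⟩ - h
      obtain ⟨h1, h2⟩ := Fin.snoc_inj.1 h
      simp only at h1 h2
      rw [h1, h2]
    · intro g h
      simp only [Finset.mem_filter, Fintype.mem_piFinset] at h
      obtain ⟨h1, h2, h3⟩ := h
      refine ⟨⟨g (Fin.last k), Fin.init g⟩, ?_, Fin.snoc_init_self g⟩
      simp only [Finset.mem_sigma, Finset.mem_filter, Fintype.mem_piFinset,
        Set.mem_insert_iff, not_or]
      refine ⟨⟨by simpa using h1 (Fin.last k), h3 _⟩, fun r => by simpa [Fin.init] using h1 r.castSucc,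
        fun r s hrs => Fin.castSucc_injective _ (h2 hrs), fun r => ⟨fun hr => ?_, h3 _⟩⟩
      exact absurd (h2 hr) (Fin.castSucc_lt_last r).ne

end Count

theorem matchings_finite_ncard (hn : 1 ≤ n) (hP : IsPeriodicTriangulation n T) (u v : ℤ)
    (huv : u ≤ v) : (matchings n T u v).Finite ∧
      ((matchings n T u v).ncard : ℤ) = count (incident n T) u (v + 1) ∅ := by
  classical
  set k := (v + 1 - u).toNat with hk
  let e : Fin k ≃ Set.Icc u v :=
    { toFun := fun r => ⟨u + (r : ℕ), by omega, by have := r.2; omega⟩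
      invFun := fun w => ⟨(w.1 - u).toNat, by have := w.2.1; have := w.2.2; omega⟩
      left_inv := fun r => by ext; simp
      right_inv := fun w => by ext; have := w.2.1; simp only; omega }
  let E : (Set.Icc u v → Triangle) ≃ (Fin k → Triangle) := e.symm.arrowCongr (Equiv.refl _)
  have hE : ∀ τ r, E τ r = τ (e r) := fun τ r => rfl
  let F := (Fintype.piFinset fun r : Fin k => incident n T (u + (r : ℕ))).filter
      fun g => Function.Injective g ∧ ∀ r, g r ∉ (∅ : Set Triangle)
  have hF : matchings n T u v = E ⁻¹' (F : Set (Fin k → Triangle)) := by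
    ext τ
    simp only [matchings, Set.mem_ofPred_eq, Set.mem_preimage, F, Finset.coe_filter,
      Fintype.mem_piFinset, Set.mem_empty_iff_false, not_false_eq_true, implies_true, and_true,
      mem_incident hn hP]
    rw [and_comm]
    refine and_congr ?_ ?_
    · rw [← e.forall_congr_right]
      rfl
    · exact (Function.Injective.of_comp_iff' (f := τ) (g := e) e.bijective).symm
  have hcount : count (incident n T) u (v + 1) ∅ = (F.card : ℤ) := by
    rw [count, countLength_eq_card]
    congr!
  rw [hcount, hF]
  refine ⟨F.finite_toSet.preimage E.injective.injOn, ?_⟩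
  rw [Set.ncard_preimage_of_injective_subset_range E.injective (by simp [E.surjective.range_eq]),
    Set.ncard_coe_finset]

/-! ### Linear relations between numbers of matchings -/

/-- Beneath a side, the triangles are matched with the vertices in exactly one way. -/
theorem count_side (hn : 1 ≤ n) (hP : IsPeriodicTriangulation n T) {i : ℤ} {a b : ℤ}
    (h : IsSide T a b) (hi : i ≤ a + 1) (X : Set Triangle) :
    (Disjoint X (beneath n T a b) → count (incident n T) i b X =
      count (incident n T) i (a + 1) (X ∪ beneath n T a b)) ∧
    (¬ Disjoint X (beneath n T a b) → count (incident n T) i b X = 0) := by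
  classical
  induction hk : (b - a).toNat using Nat.strong_induction_on generalizing a b X with
  | _ k ih =>
  have hab := h.lt hP.1
  by_cases hb : b = a + 1
  · subst hb
    simp [beneath_succ]
  obtain ⟨m, hm⟩ := h.exists_apex hP.1 (by omega)
  obtain ⟨h1, h2, s1, s2, -⟩ := id hm
  have ih1 := fun X => ih (m - a).toNat (by omega) s1 hi X rfl
  have ih2 := fun X => ih (b - m).toNat (by omega) s2 (by omega) X rfl
  set A := beneath n T a m with hA
  set B := beneath n T m b with hB
  set C := beneath n T a b with hC
  set Δ := Triangle.inner a m b with hΔ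
  -- Reading from the right, the vertices between m and b use up B, then m must receive Δ, and then
  -- the vertices between a and m use up A.
  have hABC : C = insert Δ (A ∪ B) := by
    ext τ
    refine ⟨fun hτ => eq_or_mem_beneath hP.1 hm hτ, ?_⟩
    rintro (rfl | hτ | hτ)
    · exact mem_beneath.2 ⟨hm, le_rfl, le_rfl⟩
    · exact beneath_mono le_rfl h2.le hτ
    · exact beneath_mono h1.le le_rfl hτ
  have hΔA : Δ ∉ A := fun hmem => by
    have := (mem_beneath.1 hmem).2.2
    omega
  have hΔB : Δ ∉ B := fun hmem => by
    have := (mem_beneath.1 hmem).2.1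
    omega
  have hdisj : Disjoint B A := by
    rw [Set.disjoint_left]
    rintro _ ⟨x, y, z, rfl, hxyz, hx, hz⟩ hmem
    have := (mem_beneath.1 hmem).2.2
    have := hxyz.1
    have := hxyz.2.1
    omega
  by_cases hXB : Disjoint X B
  swap
  · rw [(ih2 X).2 hXB]
    refine ⟨fun hd => (hXB (hd.mono_right ?_)).elim, fun _ => rfl⟩
    rw [hABC]
    exact Set.subset_union_right.trans (Set.subset_insert _ _)
  obtain ⟨Y, hY⟩ : ∃ Y, Y = X ∪ B := ⟨_, rfl⟩
  -- Any other free triangle at m lies in A, which the vertices between a and m need in full.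
  have hzero : ∀ τ ∈ (incident n T m).filter (· ∉ Y), τ ≠ Δ →
      count (incident n T) i m (insert τ Y) = 0 := by
    intro τ hτ hne
    rw [Finset.mem_filter, mem_incident hn hP, hY, Set.mem_union, not_or] at hτ
    obtain ⟨⟨t1, t2⟩, -, t3⟩ := hτ
    have hτC := mem_beneath_of_isIncident hP.1 h h1 h2 t1 t2
    rw [← hC, hABC] at hτC
    refine (ih1 _).2 (Set.not_disjoint_iff.2 ⟨τ, Set.mem_insert _ _, ?_⟩)
    exact (hτC.resolve_left hne).resolve_right t3
  have hΔinc : Δ ∈ incident n T m := (mem_incident hn hP).2 ⟨hm, Or.inr (Or.inl rfl)⟩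
  rw [(ih2 X).1 hXB, ← hY, count_succ _ _ (by omega)]
  by_cases hΔX : Δ ∈ X
  · rw [Finset.sum_eq_zero]
    · refine ⟨fun hd => (Set.disjoint_left.1 hd hΔX ?_).elim, fun _ => rfl⟩
      rw [hABC]
      exact Set.mem_insert _ _
    · intro τ hτ
      refine hzero τ hτ ?_
      rintro rfl
      exact (Finset.mem_filter.1 hτ).2 (hY ▸ Or.inl hΔX)
  · rw [Finset.sum_eq_single_of_mem Δ (Finset.mem_filter.2 ⟨hΔinc, by simp [hY, hΔX, hΔB]⟩) hzero]
    have hiff : Disjoint X C ↔ Disjoint (insert Δ Y) A := by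
      rw [hABC, hY, Set.disjoint_insert_left, Set.disjoint_union_left, Set.disjoint_insert_right,
        Set.disjoint_union_right]
      tauto
    rw [hiff, hABC]
    refine ⟨fun hd => ?_, (ih1 _).2⟩
    rw [(ih1 _).1 hd]
    congr 1
    ext τ
    simp only [hY, Set.mem_union, Set.mem_insert_iff]
    tauto

/-- The number of matchings of the vertices `i, …, p - 1`. -/
noncomputable def diag (n : ℕ) (T : Set Curve) (i p : ℤ) : ℤ :=
  -- The value 0 at `p = i - 1` is the zero row of the frieze and lets the linear relations start at
  -- the boundary.
  if p < i then 0 else count (incident n T) i p ∅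

theorem diag_eq {i p : ℤ} (h : i ≤ p) : diag n T i p = count (incident n T) i p ∅ :=
  if_neg (by omega)

theorem diag_self (i : ℤ) : diag n T i i = 1 := by
  rw [diag_eq le_rfl, count_self]

theorem diag_of_lt {i p : ℤ} (h : p < i) : diag n T i p = 0 := if_pos h

theorem count_eq_diag (hn : 1 ≤ n) (hP : IsPeriodicTriangulation n T) {i p : ℤ} (hp : i ≤ p)
    {X : Set Triangle} (hX : ∀ τ ∈ X, ∀ x, i ≤ x → x < p → ¬ τ.IsIncident x) :
    count (incident n T) i p X = diag n T i p := by
  rw [diag_eq hp]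
  refine count_congr _ _ hp fun r h1 h2 τ hτ => ?_
  simp only [Set.mem_empty_iff_false, iff_false]
  exact fun hτX => hX τ hτX r h1 h2 ((mem_incident hn hP).1 hτ).2

/-- Among the vertices considered only a can receive τ. If it does, the vertices i, …, a-1 are
unrestricted, since neither τ nor Y touches them; if not, τ is avoided. -/
theorem count_eq_count_insert_add (hn : 1 ≤ n) (hP : IsPeriodicTriangulation n T) {i a : ℤ}
    (hi : i ≤ a + 1) {Y : Set Triangle} {τ : Triangle} (hτ : IsTriangleOf n T τ)
    (ha : τ.IsIncident a) (hτY : τ ∉ Y)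
    (hτi : ∀ x, i ≤ x → x < a → ¬ τ.IsIncident x)
    (hYi : ∀ σ ∈ Y, ∀ x, i ≤ x → x < a → ¬ σ.IsIncident x) :
    count (incident n T) i (a + 1) Y =
      count (incident n T) i (a + 1) (insert τ Y) + diag n T i a := by
  classical
  -- If i = a+1 there is no vertex to match: both counts are 1, and the last term is the default 0.
  rcases hi.eq_or_lt with rfl | hi
  · rw [count_self, count_self, diag_of_lt (by omega), add_zero]
  have hia : i ≤ a := by omega
  have hτY' : ∀ σ ∈ insert τ Y, ∀ x, i ≤ x → x < a → ¬ σ.IsIncident x := by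
    rintro σ (rfl | hσ)
    · exact hτi
    · exact hYi σ hσ
  rw [count_succ _ _ hia, count_succ _ _ hia,
    ← Finset.sum_erase_add _ _ (Finset.mem_filter.2 ⟨(mem_incident hn hP).2 ⟨hτ, ha⟩, hτY⟩),
    count_eq_diag hn hP hia hτY']
  congr 1
  refine Finset.sum_congr ?_ fun σ _ => ?_
  · ext σ
    simp only [Finset.mem_erase, Finset.mem_filter, Set.mem_insert_iff, not_or]
    tauto
  · refine count_congr _ _ hia fun r h1 h2 ρ hρ => ?_
    have h3 : ρ ≠ τ := by
      rintro rfl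
      exact hτi r h1 h2 ((mem_incident hn hP).1 hρ).2
    simp only [Set.mem_insert_iff, h3, false_or]

theorem diag_eq_count_side (hn : 1 ≤ n) (hP : IsPeriodicTriangulation n T) {i a b : ℤ}
    (h : IsSide T a b) (hi : i ≤ a + 1) :
    diag n T i b = count (incident n T) i (a + 1) (beneath n T a b) := by
  have hab := h.lt hP.1
  rw [diag_eq (by omega), (count_side hn hP h hi ∅).1 (Set.empty_disjoint _), Set.empty_union]

theorem not_isIncident_of_mem_beneath {a b x : ℤ} {τ : Triangle} (h : τ ∈ beneath n T a b)
    (hx : x < a) : ¬ τ.IsIncident x := fun hτ => by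
  have := IsTriangleOf.incident_of_mem_beneath h hτ
  omega

/-- By rigidity, D(b) and D(c) count matchings of i, …, a that avoid the triangles beneath ab and
ac. At these vertices the two restrictions differ only by the triangle abc, and D(a) matchings give
it to a. -/
theorem diag_inner (hn : 1 ≤ n) (hP : IsPeriodicTriangulation n T) {i a b c : ℤ}
    (h : IsTriangleOf n T (.inner a b c)) (hi : i ≤ a + 1) :
    diag n T i b = diag n T i a + diag n T i c := by
  obtain ⟨h1, h2, s1, s2, s3⟩ := id h
  have hΔ : ∀ x, i ≤ x → x < a → ¬ (Triangle.inner a b c).IsIncident x := by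
    intro x _ hx
    simp only [Triangle.IsIncident]
    omega
  rw [diag_eq_count_side hn hP s1 hi, diag_eq_count_side hn hP s3 hi,
    count_eq_count_insert_add hn hP hi h (Or.inl rfl) ?_ hΔ
      (fun σ hσ x _ hx => not_isIncident_of_mem_beneath hσ hx), add_comm]
  · congr 1
    refine count_congr _ _ hi fun r _ hra τ hτ => ?_
    have hr := ((mem_incident hn hP).1 hτ).2
    constructor
    · rintro (rfl | hτ')
      · exact mem_beneath.2 ⟨h, le_rfl, le_rfl⟩
      · exact beneath_mono le_rfl h2.le hτ'
    · intro hτ'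
      rcases eq_or_mem_beneath hP.1 h hτ' with rfl | h' | h'
      · exact Set.mem_insert _ _
      · exact Or.inr h'
      · exact (not_isIncident_of_mem_beneath h' (by omega) hr).elim
  · intro hmem
    have := (mem_beneath.1 hmem).2.2
    omega

/-- The number of matchings avoiding the region above a side. -/
theorem count_singleton_isAbove (hn : 1 ≤ n) (hP : IsPeriodicTriangulation n T) {i v p : ℤ}
    {σ : Triangle} (hS : IsSide T v p) (hi : i ≤ v + 1) (hσ : IsTriangleOf n T σ)
    (h : IsAbove v p σ) (hv : σ.IsIncident v) (hσi : ∀ x, i ≤ x → x < v → ¬ σ.IsIncident x) :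
    diag n T i p - count (incident n T) i p {σ} = diag n T i v := by
  rw [(count_side hn hP hS hi {σ}).1 (Set.disjoint_singleton_left.2 h.notMem_beneath),
    diag_eq_count_side hn hP hS hi, Set.singleton_union,
    count_eq_count_insert_add hn hP hi hσ hv h.notMem_beneath hσi
      (fun τ hτ x _ hx => not_isIncident_of_mem_beneath hτ hx)]
  ring

-- Each summand is the number of matchings of i, …, p-1 that use τ. Fan induction around p: passing
-- from vp to the side xp above it moves the triangle xvp out of the sum, and `diag_inner` accounts
-- for the change.
open Classical in
theorem sum_fan (hn : 1 ≤ n) (hP : IsPeriodicTriangulation n T) {i v p : ℤ}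
    (hS : IsSide T v p) (hi : i ≤ v + 1) :
    ∑ τ ∈ incident n T p with τ ∉ beneath n T v p,
      (diag n T i p - count (incident n T) i p {τ}) = diag n T i v := by
  induction hk : (v + 1 - i).toNat using Nat.strong_induction_on generalizing v with
  | _ k ih =>
  have hvp := hS.lt hP.1
  -- End of the fan: when the region σ above vp has no vertex in [i, v), the other triangles in the
  -- sum meet no vertex in [i, p) and contribute 0.
  have hmain : ∀ σ, IsTriangleOf n T σ → IsAbove v p σ → σ.IsIncident v → σ.IsIncident p →
      (∀ x, i ≤ x → x < v → ¬ σ.IsIncident x) →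
      ∑ τ ∈ incident n T p with τ ∉ beneath n T v p,
        (diag n T i p - count (incident n T) i p {τ}) = diag n T i v := by
    intro σ hσ hab hv hp hσi
    rw [Finset.sum_eq_single_of_mem σ
      (Finset.mem_filter.2 ⟨(mem_incident hn hP).2 ⟨hσ, hp⟩, hab.notMem_beneath⟩),
      count_singleton_isAbove hn hP hS hi hσ hab hv hσi]
    intro τ hτ hne
    rw [Finset.mem_filter, mem_incident hn hP] at hτ
    rw [count_eq_diag hn hP (by omega), sub_self]
    rintro _ rfl x hx hxp hinc
    exact hne (hab.eq_of_isIncident hP.1 hS hσ hσi hτ.1.1 hτ.1.2 hτ.2 hx hxp hinc).symm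
  rcases hS.exists_above hn hP.1 with ⟨x, hx⟩ | ⟨x, hx⟩ | hx
  · by_cases hix : i ≤ x + 1
    · obtain ⟨h1, h2, s1, s2, s3⟩ := id hx
      have hΔ : Triangle.inner x v p ∈ (incident n T p).filter (· ∉ beneath n T v p) := by
        refine Finset.mem_filter.2 ⟨(mem_incident hn hP).2 ⟨hx, Or.inr (Or.inr rfl)⟩, fun h => ?_⟩
        have := (mem_beneath.1 h).2.1
        omega
      -- The triangle xvp lies beneath xp, so every matching uses it and its summand is all of D(p).
      rw [← Finset.sum_erase_add _ _ hΔ, (count_side hn hP s3 hix _).2, diag_inner hn hP hx hix,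
        ← ih (x + 1 - i).toNat (by omega) s3 hix rfl, sub_zero]
      · congr 1
        refine Finset.sum_congr ?_ fun _ _ => rfl
        ext τ
        simp only [Finset.mem_erase, Finset.mem_filter]
        refine ⟨fun ⟨t1, t2, t3⟩ => ⟨t2, fun t4 => ?_⟩, fun ⟨t1, t2⟩ => ⟨?_, t1, fun t3 => ?_⟩⟩
        · rcases eq_or_mem_beneath hP.1 hx t4 with t5 | t5 | t5
          · exact t1 t5
          · have := IsTriangleOf.incident_of_mem_beneath t5 ((mem_incident hn hP).1 t2).2
            omega
          · exact t3 t5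
        · rintro rfl
          exact t2 (mem_beneath.2 ⟨hx, le_rfl, le_rfl⟩)
        · exact t2 (beneath_mono h1.le le_rfl t3)
      · rw [Set.disjoint_singleton_left, not_not]
        exact mem_beneath.2 ⟨hx, le_rfl, le_rfl⟩
    · refine hmain _ hx (Or.inl ⟨x, rfl⟩) (Or.inr (Or.inl rfl)) (Or.inr (Or.inr rfl)) ?_
      intro y
      simp only [Triangle.IsIncident]
      omega
  · refine hmain _ hx (Or.inr (Or.inl ⟨x, rfl⟩)) (Or.inl rfl) (Or.inr (Or.inl rfl)) ?_
    intro y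
    have := hx.2.1
    simp only [Triangle.IsIncident]
    omega
  · refine hmain _ hx (Or.inr (Or.inr rfl)) (Or.inl rfl) (Or.inr rfl) ?_
    intro y
    simp only [Triangle.IsIncident]
    omega

/-- Choose the triangle of p first: each of the a_p choices leaves D(p) matchings minus those that
use it, and `sum_fan` for the boundary segment from p-1 to p totals the losses as D(p-1). -/
theorem diag_succ (hn : 1 ≤ n) (hP : IsPeriodicTriangulation n T) {i p : ℤ} (hi : i ≤ p) :
    diag n T i (p + 1) = (incident n T p).card * diag n T i p - diag n T i (p - 1) := by
  classical
  have hS : IsSide T (p - 1) p := Or.inl (by ring)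
  have hb : beneath n T (p - 1) p = ∅ := by
    have := beneath_succ n T (p - 1)
    rwa [sub_add_cancel] at this
  have h := sum_fan hn hP (i := i) hS (by omega)
  rw [← h, diag_eq (by omega : i ≤ p + 1), count_succ _ _ hi]
  simp [hb, Finset.sum_sub_distrib]

/-- Rigidity beneath bc reduces D(c) to choosing the triangle of b. The right outer triangle leaves
D(b) matchings, the left one D(b) - D(a), and every other choice none. -/
theorem diag_outer (hn : 1 ≤ n) (hP : IsPeriodicTriangulation n T) {i a b c : ℤ}
    (hab : IsTriangleOf n T (.outer a b)) (hbc : IsTriangleOf n T (.outer b c)) (hi : i ≤ a + 1) :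
    diag n T i c - diag n T i b = diag n T i b - diag n T i a := by
  classical
  obtain ⟨h1, b1, b2, s1⟩ := id hab
  obtain ⟨h2, -, b3, s2⟩ := id hbc
  have key : diag n T i c = diag n T i b + count (incident n T) i b {Triangle.outer a b} := by
    have hloc : ∀ τ x, i ≤ x → x < b → τ ∈ beneath n T b c → ¬ τ.IsIncident x :=
      fun τ x _ hx hτ => not_isIncident_of_mem_beneath hτ hx
    have hterm : ∀ τ, count (incident n T) i b (insert τ (beneath n T b c)) =
        count (incident n T) i b {τ} := by
      intro τ
      refine count_congr _ _ (by omega) fun r hr1 hr2 σ hσ => ?_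
      have : σ ∉ beneath n T b c := fun hmem =>
        hloc σ r hr1 hr2 hmem ((mem_incident hn hP).1 hσ).2
      simp [this]
    have hne : Triangle.outer b c ≠ Triangle.outer a b := by
      intro h
      injection h
      omega
    rw [diag_eq_count_side hn hP s2 (by omega), count_succ _ _ (by omega),
      Finset.sum_congr rfl fun τ _ => hterm τ,
      Finset.sum_eq_add_of_mem (Triangle.outer b c) (Triangle.outer a b)
      (Finset.mem_filter.2 ⟨(mem_incident hn hP).2 ⟨hbc, Or.inl rfl⟩, outer_notMem_beneath⟩)
      (Finset.mem_filter.2 ⟨(mem_incident hn hP).2 ⟨hab, Or.inr rfl⟩, outer_notMem_beneath⟩) hne,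
      count_eq_diag hn hP (by omega)]
    · rintro _ rfl x _ hx
      simp only [Triangle.IsIncident]
      omega
    · rintro τ hτ ⟨n1, n2⟩
      rw [Finset.mem_filter, mem_incident hn hP] at hτ
      obtain ⟨⟨hτ, hb⟩, hτ2⟩ := hτ
      -- Any remaining triangle at b lies beneath ab, where all triangles are already needed.
      refine (count_side hn hP s1 hi _).2 ?_
      rw [Set.disjoint_singleton_left, not_not]
      by_contra hτ1
      have hl : ∀ x, x < b → τ.IsIncident x → False := by
        intro x hx hxτ
        refine n2 (IsAbove.eq_of_isIncident hP.1 (i := x) s1 (Or.inr (Or.inr rfl)) hab ?_ hτ hb hτ1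
          le_rfl hx hxτ).symm
        intro y hxy hya hy
        have := IsBridge.not_inside hP.1 b1 (hτ.isSide hxτ hb hx) (by omega)
        omega
      rcases τ with ⟨x, y, z⟩ | ⟨x, y⟩
      · obtain ⟨k1, k2, t1, t2, t3⟩ := id hτ
        have hx : ¬ x < b := fun h => hl x h (Or.inl rfl)
        have hy : ¬ y < b := fun h => hl y h (Or.inr (Or.inl rfl))
        have hbx : b = x := by
          simp only [Triangle.IsIncident] at hb
          omega
        subst hbx
        refine hτ2 (mem_beneath.2 ⟨hτ, le_rfl, ?_⟩)
        by_contra! hlt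
        have := IsBridge.not_inside hP.1 b3 t3 h2
        omega
      · obtain ⟨k1, c1, c2, t⟩ := id hτ
        have hx : ¬ x < b := fun h => hl x h (Or.inl rfl)
        have hbx : b = x := by
          simp only [Triangle.IsIncident] at hb
          omega
        subst hbx
        have := IsBridge.not_inside hP.1 b3 t h2
        have := IsBridge.not_inside hP.1 c2 s2 k1
        exact n1 (by rw [show y = c by omega])
  have := count_singleton_isAbove hn hP s1 hi hab (Or.inr (Or.inr rfl)) (Or.inl rfl) (by
    intro x _ hx
    simp only [Triangle.IsIncident]
    omega)
  linarith

/-! ### The frieze of a triangulation -/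

/-- An explicit matching: each vertex takes a triangle of which it is the middle vertex or, at a
bridging arc, the outer triangle on its left. Either kind of triangle determines its vertex, so the
choices are distinct. -/
theorem diag_pos (hn : 1 ≤ n) (hP : IsPeriodicTriangulation n T) {i p : ℤ} (h : i ≤ p) :
    0 < diag n T i p := by
  have hex : ∀ r, ∃ τ, IsTriangleOf n T τ ∧ ((∃ a c, τ = .inner a r c) ∨ ∃ a, τ = .outer a r) := by
    intro r
    by_cases hr : IsBridge n T r
    · obtain ⟨q, hqr, hq⟩ := exists_isBridge_lt hn hP r
      obtain ⟨a, -, ha⟩ := hq.exists_outer hP.1 hr hqr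
      exact ⟨_, ha, Or.inr ⟨a, rfl⟩⟩
    · obtain ⟨a, c, h⟩ := exists_middle hn hP.1 hr
      exact ⟨_, h, Or.inl ⟨a, c, rfl⟩⟩
  choose θ hθ hθ' using hex
  rw [diag_eq h]
  refine count_pos _ _ h θ ?_ ?_ fun r _ _ => Set.notMem_empty _
  · intro r s hrs
    rcases hθ' r with ⟨a, c, h1⟩ | ⟨a, h1⟩ <;> rcases hθ' s with ⟨b, d, h2⟩ | ⟨b, h2⟩ <;>
      rw [h1, h2] at hrs <;> injection hrs
  · intro r
    refine (mem_incident hn hP).2 ⟨hθ r, ?_⟩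
    rcases hθ' r with ⟨a, c, h1⟩ | ⟨a, h1⟩ <;> rw [h1]
    · exact Or.inr (Or.inl rfl)
    · exact Or.inr rfl

theorem card_incident_add (hn : 1 ≤ n) (hP : IsPeriodicTriangulation n T) (p t : ℤ) :
    (incident n T (p + t * n)).card = (incident n T p).card := by
  let shift : ℤ → Triangle → Triangle := fun t τ => match τ with
    | .inner a b c => .inner (a + t * n) (b + t * n) (c + t * n)
    | .outer a b => .outer (a + t * n) (b + t * n)
  have hmem : ∀ (t p : ℤ) (τ : Triangle), τ ∈ incident n T p →
      shift t τ ∈ incident n T (p + t * n) := by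
    intro t p τ hτ
    rw [mem_incident hn hP] at hτ ⊢
    rcases τ with ⟨a, b, c⟩ | ⟨a, b⟩
    · obtain ⟨⟨h1, h2, s1, s2, s3⟩, hp⟩ := hτ
      refine ⟨⟨by omega, by omega, s1.add_mul hP t, s2.add_mul hP t, s3.add_mul hP t⟩, ?_⟩
      rcases hp with rfl | rfl | rfl
      exacts [Or.inl rfl, Or.inr (Or.inl rfl), Or.inr (Or.inr rfl)]
    · obtain ⟨⟨h1, b1, b2, s⟩, hp⟩ := hτ
      refine ⟨⟨by omega, IsBridge.add_mul hn hP b1 t, IsBridge.add_mul hn hP b2 t,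
        s.add_mul hP t⟩, ?_⟩
      rcases hp with rfl | rfl
      exacts [Or.inl rfl, Or.inr rfl]
  have hinv : ∀ t τ, shift (-t) (shift t τ) = τ := by
    rintro t (⟨a, b, c⟩ | ⟨a, b⟩) <;> simp only [shift] <;> congr 1 <;> ring
  refine (Finset.card_bij' (fun τ _ => shift t τ) (fun τ _ => shift (-t) τ) (hmem t p) ?_
    (fun τ _ => hinv t τ) (fun τ _ => ?_)).symm
  · intro τ hτ
    have := hmem (-t) _ τ hτ
    rwa [show p + t * n + -t * n = p by ring] at this
  · have := hinv (-t) τ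
    rwa [neg_neg] at this

/-- The recurrence has two terms, so the induction carries two consecutive values. -/
theorem diag_add (hn : 1 ≤ n) (hP : IsPeriodicTriangulation n T) (i p t : ℤ) (hp : i ≤ p) :
    diag n T (i + t * n) (p + t * n) = diag n T i p ∧
      diag n T (i + t * n) (p - 1 + t * n) = diag n T i (p - 1) := by
  induction p, hp using Int.leInduction with
  | base => simp [diag_self, diag_of_lt]
  | succ p hp ih =>
    rw [show p + 1 + t * (n : ℤ) = (p + t * n) + 1 by ring, add_sub_cancel_right,
      diag_succ hn hP (by omega), diag_succ hn hP hp, card_incident_add hn hP, ih.1,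
      show p + t * (n : ℤ) - 1 = p - 1 + t * n by ring, ih.2]
    exact ⟨rfl, rfl⟩

/-- Two solutions of the same recurrence have a constant Casorati determinant. -/
theorem diag_unimodular (hn : 1 ≤ n) (hP : IsPeriodicTriangulation n T) {i p : ℤ} (hp : i ≤ p) :
    diag n T i p * diag n T (i + 1) (p + 1) - diag n T (i + 1) p * diag n T i (p + 1) = 1 := by
  induction p, hp using Int.leInduction with
  | base => simp [diag_self, diag_of_lt]
  | succ p hp ih =>
    rw [diag_succ hn hP (by omega : i + 1 ≤ p + 1), diag_succ hn hP (by omega : i ≤ p + 1),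
      add_sub_cancel_right]
    linarith

theorem quiddity_eq (hn : 1 ≤ n) (hP : IsPeriodicTriangulation n T) (i : ℤ) :
    quiddity n T i = (incident n T i).card := by
  rw [quiddity, ← Set.ncard_coe_finset]
  congr 1
  ext τ
  simp [mem_incident hn hP, pos]

theorem diag_isAssociatedFrieze (hn : 1 ≤ n) (hP : IsPeriodicTriangulation n T) :
    IsAssociatedFrieze n T fun i j => diag n T i (j + 1) := by
  refine ⟨⟨fun i => ?_, fun i => ?_, fun i j h => ?_, fun i j h => ?_⟩, ⟨hn, fun i j h => ?_⟩,
    fun i _ _ => ?_⟩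
  · exact diag_of_lt (by omega)
  · simp [diag_self]
  · exact diag_pos hn hP (by omega)
  · exact diag_unimodular hn hP (by omega)
  · have := (diag_add hn hP i (j + 1) 1 (by omega)).1
    rw [one_mul] at this
    simp only
    rw [← this]
    congr 1
    ring
  · simp only
    rw [diag_succ hn hP le_rfl, diag_self, diag_of_lt (by omega), quiddity_eq hn hP]
    ring

/-! ### Uniqueness of the frieze -/

theorem IsAssociatedFrieze.eq_diag (hn : 1 ≤ n) (hP : IsPeriodicTriangulation n T)
    {m : ℤ → ℤ → ℤ} (hm : IsAssociatedFrieze n T m) {i j : ℤ} (h : i - 2 ≤ j) :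
    m i j = diag n T i (j + 1) := by
  obtain ⟨hf, ⟨-, hper⟩, hq⟩ := hm
  have hn' : (0 : ℤ) < n := by exact_mod_cast hn
  have hper' : ∀ (k : ℕ) (i : ℤ), m (i + k * n) (i + k * n) = m i i := by
    intro k
    induction k with
    | zero => simp
    | succ k ih =>
      intro i
      rw [← ih i, hper (i + k * n) _ le_rfl]
      push_cast
      ring_nf
  have hquid : ∀ i, m i i = (incident n T i).card := by
    intro i
    have h1 := Int.emod_add_mul_ediv (i - 1) n
    have h2 := Int.emod_nonneg (i - 1) hn'.ne'
    have h3 := Int.emod_lt_of_pos (i - 1) hn'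
    set r := (i - 1) % (n : ℤ) + 1 with hr
    set t := (i - 1) / (n : ℤ) with ht
    have hi : i = r + t * n := by
      rw [hr]
      linarith
    have hmr : m i i = m r r := by
      rcases le_total 0 t with h0 | h0
      · have := hper' t.toNat r
        rwa [Int.toNat_of_nonneg h0, ← hi] at this
      · have := hper' (-t).toNat i
        rw [Int.toNat_of_nonneg (by omega), show i + -t * n = r by linarith] at this
        exact this.symm
    rw [hmr, hq r (by omega) (by omega), quiddity_eq hn hP, hi, card_incident_add hn hP]
  -- Row by row: the unimodular rule gives each entry from the two preceding rows, on division by a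
  -- positive entry.
  have main : ∀ k : ℕ, ∀ i, m i (i - 1 + k) = diag n T i (i + k) ∧
      m i (i + k) = diag n T i (i + k + 1) := by
    intro k
    induction k with
    | zero =>
      intro i
      simp only [Nat.cast_zero, add_zero]
      rw [hf.one_row, hquid, diag_self, diag_succ hn hP le_rfl, diag_self, diag_of_lt (by omega)]
      simp
    | succ k ih =>
      intro i
      have e1 : m i (i + k) = diag n T i (i + k + 1) := (ih i).2
      have e2 : m (i + 1) (i + k) = diag n T (i + 1) (i + k + 1) := by
        have := (ih (i + 1)).1
        rwa [add_sub_cancel_right, add_right_comm] at this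
      have e3 : m (i + 1) (i + k + 1) = diag n T (i + 1) (i + k + 1 + 1) := by
        have := (ih (i + 1)).2
        rwa [add_right_comm] at this
      push_cast
      rw [show i - 1 + ((k : ℤ) + 1) = i + k by ring, ← add_assoc]
      refine ⟨e1, ?_⟩
      have h1 := hf.unimodular i (i + k) (by omega)
      have h2 := diag_unimodular hn hP (show i ≤ i + k + 1 by omega)
      have h3 := diag_pos hn hP (show i + 1 ≤ i + k + 1 by omega)
      rw [e1, e2, e3] at h1
      refine mul_left_cancel₀ h3.ne' ?_
      linarith
  rcases (show j = i - 2 ∨ j = i - 1 ∨ i ≤ j by omega) with rfl | rfl | hij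
  · rw [hf.zero_row, diag_of_lt (by omega)]
  · rw [hf.one_row, sub_add_cancel, diag_self]
  · have := (main (j - i).toNat i).2
    rwa [Int.toNat_of_nonneg (by omega), add_sub_cancel] at this

/-! ### Arithmetic progressions on the diagonals -/

theorem isBridge_induction (hT : IsTriangulation n T) {q : ℤ} (hq : IsBridge n T q) {P : ℤ → Prop}
    (h0 : P q) (hs : ∀ a b, q ≤ a → IsTriangleOf n T (.outer a b) → P a → P b) {b : ℤ}
    (hb : IsBridge n T b) (hqb : q ≤ b) : P b := by
  induction hk : (b - q).toNat using Nat.strong_induction_on generalizing b with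
  | _ k ih =>
  rcases hqb.eq_or_lt with rfl | hlt
  · exact h0
  · obtain ⟨a, ha, hab⟩ := hq.exists_outer hT hb hlt
    exact hs a b ha hab (ih (a - q).toNat (by have := hab.1; omega) hab.2.1 ha rfl)

theorem IsTriangleOf.outer_add (hn : 1 ≤ n) (hP : IsPeriodicTriangulation n T) {a b : ℤ}
    (h : IsTriangleOf n T (.outer a b)) (t : ℤ) :
    IsTriangleOf n T (.outer (a + t * n) (b + t * n)) := by
  obtain ⟨h1, b1, b2, s⟩ := h
  exact ⟨by omega, IsBridge.add_mul hn hP b1 t, IsBridge.add_mul hn hP b2 t, s.add_mul hP t⟩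

/-- The entries of a diagonal at the bridging arcs increase by a constant. -/
theorem exists_diag_outer (hn : 1 ≤ n) (hP : IsPeriodicTriangulation n T) {i q : ℤ}
    (hq : IsBridge n T q) (hi : i ≤ q + 1) : ∃ δ, ∀ a b, q ≤ a → IsTriangleOf n T (.outer a b) →
      diag n T i b - diag n T i a = δ := by
  by_cases hex : ∃ b, IsTriangleOf n T (.outer q b)
  · obtain ⟨b, hb⟩ := hex
    have huniq : ∀ c, IsTriangleOf n T (.outer q c) → c = b := by
      intro c hc
      have h1 := IsBridge.not_inside hP.1 hc.2.2.1 hb.2.2.2 hc.1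
      have h2 := IsBridge.not_inside hP.1 hb.2.2.1 hc.2.2.2 hb.1
      omega
    refine ⟨diag n T i b - diag n T i q, fun a c ha hac => ?_⟩
    refine isBridge_induction hP.1 hq (P := fun a => ∀ c, IsTriangleOf n T (.outer a c) →
      diag n T i c - diag n T i a = diag n T i b - diag n T i q) ?_ ?_ hac.2.1 ha c hac
    · intro c hc
      rw [huniq c hc]
    · intro a c ha hac ih d hcd
      rw [diag_outer hn hP hac hcd (by omega), ih c hac]
  -- This case is void: walking back from a bridging arc to the right of q, outer triangle by outer
  -- triangle, ends with one that starts at q.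
  · obtain ⟨r, hr, hrb⟩ := exists_isBridge_gt hn hP q
    refine absurd ?_ hex
    refine isBridge_induction hP.1 hq (P := fun r => q < r → ∃ b, IsTriangleOf n T (.outer q b))
      (fun h => (lt_irrefl _ h).elim) ?_ hrb hr.le hr
    intro a b ha hab ih _
    rcases ha.eq_or_lt with rfl | hlt
    · exact ⟨b, hab⟩
    · exact ih hlt

/-- An outer triangle and its translate by one period both add the same δ, so D(a+n) - D(a) is the
same at all bridging positions a ≥ q, in particular at q and q+n. -/
theorem diag_second_difference_of_isBridge (hn : 1 ≤ n) (hP : IsPeriodicTriangulation n T)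
    {i q : ℤ} (hq : IsBridge n T q) (hi : i ≤ q + 1) :
    diag n T i (q + 2 * n) - 2 * diag n T i (q + n) + diag n T i q = 0 := by
  obtain ⟨δ, hδ⟩ := exists_diag_outer hn hP hq hi
  have hb := hq.add_mul hn hP 1
  rw [one_mul] at hb
  have := isBridge_induction hP.1 hq (P := fun a => diag n T i (a + n) - diag n T i a =
    diag n T i (q + n) - diag n T i q) rfl ?_ hb (by omega)
  · rw [show q + 2 * (n : ℤ) = q + n + n by ring]
    linarith
  · intro a b ha hab ih
    have h1 := hδ a b ha hab
    have h2 := hab.outer_add hn hP 1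
    rw [one_mul] at h2
    have h3 := hδ _ _ (by omega) h2
    linarith

theorem diag_second_difference (hn : 1 ≤ n) (hP : IsPeriodicTriangulation n T) {i p : ℤ}
    (hp : i ≤ p + 1) :
    diag n T i (p + 2 * n) - 2 * diag n T i (p + n) + diag n T i p = 0 := by
  set E : ℤ → ℤ := fun p => diag n T i (p + 2 * n) - 2 * diag n T i (p + n) + diag n T i p with hE
  have hrec : ∀ p, i ≤ p → E (p + 1) = (incident n T p).card * E p - E (p - 1) := by
    intro p hp
    simp only [hE]
    rw [show p + 1 + 2 * (n : ℤ) = p + 2 * n + 1 by ring,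
      show p + 1 + (n : ℤ) = p + n + 1 by ring, diag_succ hn hP (by omega : i ≤ p + 2 * n),
      diag_succ hn hP (by omega : i ≤ p + n), diag_succ hn hP hp, card_incident_add hn hP]
    have := card_incident_add hn hP p 1
    rw [one_mul] at this
    rw [this, show p + 2 * (n : ℤ) - 1 = p - 1 + 2 * n by ring,
      show p + (n : ℤ) - 1 = p - 1 + n by ring]
    ring
  obtain ⟨q, hq, hqb⟩ := exists_isBridge_gt hn hP p
  have hq0 : E q = 0 := diag_second_difference_of_isBridge hn hP hqb (by omega)
  -- Since E(q) = 0, E is a multiple of the solution with values 0 at q and 1 at q+1. That solution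
  -- is positive at q+n, where E vanishes too, so E(q+1) = 0.
  have hprop : ∀ s, q + 1 ≤ s → E s = E (q + 1) * diag n T (q + 1) s ∧
      E (s - 1) = E (q + 1) * diag n T (q + 1) (s - 1) := by
    intro s hs
    induction s, hs using Int.leInduction with
    | base => simp [diag_self, diag_of_lt, hq0]
    | succ s hs ih =>
      rw [hrec s (by omega), diag_succ hn hP hs, add_sub_cancel_right]
      refine ⟨?_, ih.1⟩
      rw [ih.1, ih.2]
      ring
  have hq1 : E (q + 1) = 0 := by
    have h1 := (hprop (q + n) (by omega)).1
    have h2 : IsBridge n T (q + n) := by simpa using hqb.add_mul hn hP 1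
    have h3 : E (q + n) = 0 := diag_second_difference_of_isBridge hn hP h2 (by omega)
    have h4 := diag_pos hn hP (show q + 1 ≤ q + n by omega)
    rw [h3] at h1
    exact (mul_eq_zero.1 h1.symm).resolve_right h4.ne'
  -- Two consecutive zeros propagate to the left, since the recurrence can be solved for E(p-1).
  have hback : ∀ k : ℕ, i ≤ q - k + 1 → E (q - k) = 0 ∧ E (q - k + 1) = 0 := by
    intro k
    induction k with
    | zero => intro _; simpa using ⟨hq0, hq1⟩
    | succ k ih =>
      intro hk
      push_cast at hk ⊢
      obtain ⟨h1, h2⟩ := ih (by omega)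
      have h3 := hrec (q - k) (by omega)
      rw [h1, h2] at h3
      rw [show q - ((k : ℤ) + 1) + 1 = q - k by ring,
        show q - ((k : ℤ) + 1) = q - k - 1 by ring]
      exact ⟨by linarith, h1⟩
  have := (hback (q - p).toNat (by omega)).1
  rwa [show q - ((q - p).toNat : ℤ) = p by omega] at this

theorem diag_arithmetic (hn : 1 ≤ n) (hP : IsPeriodicTriangulation n T) {i p : ℤ}
    (hp : i ≤ p + 1) (l : ℕ) :
    diag n T i (p + ((l : ℤ) + 1) * n) - diag n T i (p + l * n) =
      diag n T i (p + n) - diag n T i p := by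
  induction l with
  | zero => simp
  | succ l ih =>
    have h0 : (0 : ℤ) ≤ l * n := by positivity
    have := diag_second_difference hn hP (i := i) (p := p + l * n) (by omega)
    push_cast
    rw [show p + (l : ℤ) * n + 2 * n = p + ((l : ℤ) + 1 + 1) * n by ring,
      show p + (l : ℤ) * n + n = p + ((l : ℤ) + 1) * n by ring] at this
    linarith

end Strip

theorem mainTheorem3 (n : ℕ) (hn : 1 ≤ n) (T : Set Strip.Curve)
    (hT : Strip.IsPeriodicTriangulation n T) :
    (∃ m : ℤ → ℤ → ℤ, Strip.IsAssociatedFrieze n T m) ∧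
    ∀ m : ℤ → ℤ → ℤ, Strip.IsAssociatedFrieze n T m →
      IsArithmeticFrieze n m ∧
      ∀ i j k : ℤ, i ≤ j →
        (Strip.matchings n T (Strip.pos n i k) (Strip.pos n j k)).Finite ∧
        m i j = ((Strip.matchings n T (Strip.pos n i k) (Strip.pos n j k)).ncard : ℤ) := by
  refine ⟨⟨_, Strip.diag_isAssociatedFrieze hn hT⟩, fun m hm => ⟨⟨hn, ?_⟩, ?_⟩⟩
  · intro i k hk _ l
    have h0 : (0 : ℤ) ≤ l * n := by positivity
    have h1 : (0 : ℤ) ≤ ((l : ℤ) + 1) * n := by positivity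
    unfold commonDifference
    rw [hm.eq_diag hn hT (by omega), hm.eq_diag hn hT (by omega), hm.eq_diag hn hT (by omega),
      hm.eq_diag hn hT (by omega)]
    -- The case k = 1 starts on the zero row, at p = i-1, the lowest position that `diag_arithmetic`
    -- allows.
    have := Strip.diag_arithmetic hn hT (i := i) (p := i + k - 3 + 1) (by omega) l
    simp only [add_right_comm _ _ (1 : ℤ)] at this ⊢
    exact this
  · intro i j k hij
    have h := Strip.matchings_finite_ncard hn hT (Strip.pos n i k) (Strip.pos n j k)
      (by unfold Strip.pos; omega)
    refine ⟨h.1, ?_⟩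
    rw [h.2, hm.eq_diag hn hT (by omega), ← (Strip.diag_add hn hT i (j + 1) k (by omega)).1,
      Strip.diag_eq (by omega)]
    unfold Strip.pos
    congr 1
    ring
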